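/- Let $a,b,c$ be nonzero real numbers with $b^2-4ac>0$. Let $\{P_m(z)\}_{m\ge 0}$ be the sequence of functions of $z\in\mathbb{C}$ generated by \[ \sum_{m=0}^\infty P_m(z)\,t^m=\frac{1}{(at^2+bt+c)(1-tz)}, \] i.e. for every $z\in\mathbb{C}$, $P_m(z)$ is the coefficient of $t^m$ in the power series expansion of the right-hand side (as a function of $t$) in a neighbourhood of $t=0$. Let $\mathcal{Z}(P_m)\subseteq\mathbb{C}$ be the set of complex zeros of $P_m$. Let $\limsup\mathcal{Z}(P_m)$ be the set of $z^*\in\mathbb{C}$ such that for every $r>0$ and every $N\in\mathbb{N}$ there is $m>N$ with $B(r,z^*)\cap\mathcal{Z}(P_m)\neq\emptyset$, and let $\liminf\mathcal{Z}(P_m)$ be the set of $z^*\in\mathbb{C}$ such that for every $r>0$ there is $N_r\in\mathbb{N}$ with $B(r,z^*)\cap\mathcal{Z}(P_m)\neq\emptyset$ for all $m>N_r$, where $B(r,z^*)$ is the open disk of radius $r$ centered at $z^*$. Let $t_1$ be the zero of $at^2+bt+c$ of smallest modulus. Then \[ \liminf\mathcal{Z}(P_m)=\limsup\mathcal{Z}(P_m)=\left\{z\in\mathbb{C}: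 |z|=\frac{1}{|t_1|}\right\}. \] -/

import Mathlib

open scoped Topology

/-- The sequence of functions `P 0, P 1, P 2, …` of the variable `z` is generated by `f t z`:
for every `z`, `P m z` is the coefficient of `t ^ m` in the power series expansion of
`t ↦ f t z`, valid in a neighbourhood of the origin. -/
def HasGeneratingFunction (P : ℕ → ℂ → ℂ) (f : ℂ → ℂ → ℂ) : Prop :=
  ∀ z : ℂ, ∀ᶠ t in 𝓝 (0 : ℂ), HasSum (fun m : ℕ => P m z * t ^ m) (f t z)

/-- The set of zeros of `f` in the region `D`. -/
def zerosIn (D : Set ℂ) (f : ℂ → ℂ) : Set ℂ :=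
  {z | z ∈ D ∧ f z = 0}

/-- `limsup 𝒵(f_m)`: the points of `D` all of whose balls contain zeros of `f m`
for arbitrarily large `m`. -/
def limsupZeros (D : Set ℂ) (f : ℕ → ℂ → ℂ) : Set ℂ :=
  {z | z ∈ D ∧ ∀ r : ℝ, 0 < r → ∀ N : ℕ, ∃ m > N, (Metric.ball z r ∩ zerosIn D (f m)).Nonempty}

/-- `liminf 𝒵(f_m)`: the points of `D` all of whose balls contain zeros of `f m`
for all sufficiently large `m`. -/
def liminfZeros (D : Set ℂ) (f : ℕ → ℂ → ℂ) : Set ℂ :=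
  {z | z ∈ D ∧ ∀ r : ℝ, 0 < r → ∃ N : ℕ, ∀ m > N, (Metric.ball z r ∩ zerosIn D (f m)).Nonempty}

open Filter

/-! The roots `x`, `y` of the quadratic are real with `|x| < |y|`. With `s = x / y` and `w = x * z`,
the zeros of `P m` become those of `homogDiff s m`, and after multiplication by `(w - 1) * (w - s)`
they satisfy, for `n = m + 2`, the equation `w ^ n * (1 - s) = (w - s) - s ^ n * (w - 1)`.

On the unit circle `s ^ n` is negligible. Writing `w = exp u` and taking logarithms gives `u =
2πik/n + (1/n) log g(u, s ^ n)`, a small perturbation of `u = 2πik/n`; the angles `2πk/n` approach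
any given angle, so zeros accumulate at every point of the circle, for every large `n`
(`eventually_exists_pow_mul_eq`). Off the circle, size estimates exclude zeros
(`eventually_homogDiff_ne_zero_of_lt`, `eventually_homogDiff_ne_zero_of_gt`). -/

theorem eventually_exists_eq_add_mul {F : ℂ × ℂ → ℂ} {F' : ℂ × ℂ →L[ℂ] ℂ} {u₀ : ℂ}
    (hF : HasStrictFDerivAt F F' (u₀, 0)) {V : Set ℂ} (hV : V ∈ 𝓝 u₀) :
    ∀ᶠ p : ℂ × ℂ × ℂ in 𝓝 (u₀, 0, 0), ∃ u ∈ V, u = p.1 + p.2.1 * F (u, p.2.2) := by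
  -- Implicit function argument: at `q₀` the factor multiplying `F` vanishes, so the derivative of
  -- `Φ` in `u` is the identity and `Φ` is locally open.
  let Φ : ℂ × (ℂ × ℂ × ℂ) → ℂ × (ℂ × ℂ × ℂ) :=
    fun q => (q.1 - q.2.1 - q.2.2.1 * F (q.1, q.2.2.2), q.2)
  let q₀ : ℂ × (ℂ × ℂ × ℂ) := (u₀, u₀, 0, 0)
  have h1 : HasStrictFDerivAt (fun q : ℂ × (ℂ × ℂ × ℂ) => q.1) (ContinuousLinearMap.fst ℂ _ _) q₀ :=
    hasStrictFDerivAt_fst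
  have h2 : HasStrictFDerivAt (fun q : ℂ × (ℂ × ℂ × ℂ) => q.2) (ContinuousLinearMap.snd ℂ _ _) q₀ :=
    hasStrictFDerivAt_snd
  have h21 := h2.fst
  have h22 := h2.snd
  have h3 : HasStrictFDerivAt (fun q : ℂ × (ℂ × ℂ × ℂ) => F (q.1, q.2.2.2)) _ q₀ :=
    HasStrictFDerivAt.comp q₀ (g := F) hF (h1.prodMk h22.snd)
  have hΦ : HasStrictFDerivAt Φ _ q₀ := ((h1.sub h21).sub (h22.fst.mul h3)).prodMk h2
  have hmap := hΦ.map_nhds_eq_of_surj (by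
    rw [LinearMap.range_eq_top]
    rintro ⟨y, v, x, e⟩
    refine ⟨(y + v + F (u₀, 0) * x, v, x, e), ?_⟩
    simp [q₀]
    ring)
  have hΦq : Φ q₀ = (0, u₀, 0, 0) := by simp [Φ, q₀]
  have hmem : Φ '' {q | q.1 ∈ V} ∈ 𝓝 ((0 : ℂ), u₀, (0 : ℂ), (0 : ℂ)) := by
    rw [← hΦq, ← hmap]
    exact image_mem_map (continuous_fst.continuousAt.preimage_mem_nhds hV)
  have hc : Tendsto (fun p : ℂ × ℂ × ℂ => ((0 : ℂ), p)) (𝓝 (u₀, 0, 0)) (𝓝 (0, u₀, 0, 0)) :=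
    Continuous.tendsto (by fun_prop) _
  filter_upwards [hc hmem] with p hp
  obtain ⟨⟨u, q⟩, hu, hq⟩ := hp
  simp only [Φ, Prod.mk.injEq] at hq
  obtain ⟨hq1, rfl⟩ := hq
  exact ⟨u, hu, by linear_combination hq1⟩

theorem tendsto_two_pi_floor_div (θ : ℝ) :
    Tendsto (fun n : ℕ => 2 * Real.pi * (⌊θ / (2 * Real.pi) * n⌋ : ℝ) / n) atTop (𝓝 θ) := by
  have h0 : Tendsto (fun n : ℕ => (2 * Real.pi) * ((n : ℝ)⁻¹)) atTop (𝓝 0) := by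
    simpa using (tendsto_inv_atTop_nhds_zero_nat (𝕜 := ℝ)).const_mul (2 * Real.pi)
  have h1 : Tendsto (fun n : ℕ => θ - (2 * Real.pi) * ((n : ℝ)⁻¹)) atTop (𝓝 θ) := by
    simpa using h0.const_sub θ
  have hθ : ∀ n : ℕ, 2 * Real.pi * (θ / (2 * Real.pi) * n) = θ * n := fun n => by
    field_simp
  refine tendsto_of_tendsto_of_tendsto_of_le_of_le' h1 tendsto_const_nhds ?_ ?_ <;>
    filter_upwards [eventually_gt_atTop 0] with n hn
  · have hn' : (0 : ℝ) < n := by exact_mod_cast hn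
    rw [le_div_iff₀ hn', sub_mul, mul_assoc, inv_mul_cancel₀ hn'.ne', ← hθ, ← mul_sub]
    exact mul_le_mul_of_nonneg_left (Int.sub_one_lt_floor _).le (by positivity)
  · have hn' : (0 : ℝ) < n := by exact_mod_cast hn
    rw [div_le_iff₀ hn', ← hθ]
    exact mul_le_mul_of_nonneg_left (Int.floor_le _) (by positivity)

theorem eventually_exists_pow_mul_eq {s : ℝ} (hs : |s| < 1) {θ : ℝ} (hθ : Real.sin θ ≠ 0)
    {U : Set ℂ} (hU : U ∈ 𝓝 (Complex.exp (θ * Complex.I))) :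
    ∀ᶠ n : ℕ in atTop, ∃ w ∈ U, w.im ≠ 0 ∧ w ^ n * (1 - s) = (w - s) - s ^ n * (w - 1) := by
  have hs1 : 0 < 1 - s := by linarith [le_abs_self s]
  have hs1' : (1 - s : ℂ) ≠ 0 := by exact_mod_cast hs1.ne'
  let g : ℂ × ℂ → ℂ := fun p => ((Complex.exp p.1 - s) - p.2 * (Complex.exp p.1 - 1)) / (1 - s : ℝ)
  let u₀ : ℂ := θ * Complex.I
  -- The imaginary part is `sin θ / (1 - s)`; this is why the angle must be nonreal for the
  -- principal logarithm.
  have hg0 : g (u₀, 0) ∈ Complex.slitPlane := by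
    right
    simp only [g, zero_mul, sub_zero, Complex.div_ofReal_im, Complex.sub_im, Complex.ofReal_im, u₀,
      Complex.exp_ofReal_mul_I_im]
    exact div_ne_zero hθ hs1.ne'
  have hgc : ContDiff ℂ 1 g := by
    simp only [g]
    fun_prop
  have hlog : HasStrictFDerivAt (fun p => Complex.log (g p)) _ (u₀, 0) :=
    (hgc.contDiffAt.hasStrictFDerivAt one_ne_zero).clog hg0
  have hgV : ∀ᶠ p in 𝓝 (u₀, (0 : ℂ)), g p ≠ 0 :=
    hgc.continuous.continuousAt.eventually_ne (Complex.slitPlane_ne_zero hg0)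
  rw [nhds_prod_eq] at hgV
  obtain ⟨pu, hpu, pe, hpe, hpg⟩ := eventually_prod_iff.1 hgV
  have hV : {u | Complex.exp u ∈ U ∧ (Complex.exp u).im ≠ 0 ∧ pu u} ∈ 𝓝 u₀ := by
    have hc : ContinuousAt Complex.exp u₀ := Complex.continuous_exp.continuousAt
    have him : (Complex.exp u₀).im ≠ 0 := by simpa [u₀, Complex.exp_ofReal_mul_I_im] using hθ
    filter_upwards [hc hU, (Complex.continuous_im.continuousAt.comp hc).eventually_ne him, hpu] with u h1 h2 h3
    exact ⟨h1, h2, h3⟩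
  have hev := eventually_exists_eq_add_mul hlog hV
  have hpow : Tendsto (fun n : ℕ => (s : ℂ) ^ n) atTop (𝓝 0) :=
    tendsto_pow_atTop_nhds_zero_of_norm_lt_one (by simpa using hs)
  have htend : Tendsto (fun n : ℕ =>
      (((2 * Real.pi * (⌊θ / (2 * Real.pi) * n⌋ : ℝ) / n : ℝ) : ℂ) * Complex.I,
        (n : ℂ)⁻¹, (s : ℂ) ^ n)) atTop (𝓝 (u₀, 0, 0)) := by
    refine Tendsto.prodMk_nhds ?_ (Tendsto.prodMk_nhds ?_ hpow)
    · exact ((Complex.continuous_ofReal.tendsto _).comp (tendsto_two_pi_floor_div θ)).mul_const _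
    · exact tendsto_inv_atTop_nhds_zero_nat
  filter_upwards [htend.eventually hev, hpow.eventually hpe, eventually_gt_atTop 0]
    with n ⟨u, ⟨huU, huim, hup⟩, hu⟩ hen hn
  refine ⟨Complex.exp u, huU, huim, ?_⟩
  have hn' : (n : ℂ) ≠ 0 := by exact_mod_cast hn.ne'
  have hnu : (n : ℂ) * u = (⌊θ / (2 * Real.pi) * n⌋ : ℤ) * (2 * Real.pi * Complex.I)
      + Complex.log (g (u, s ^ n)) := by
    conv_lhs => rw [hu]
    push_cast
    field_simp
  rw [← Complex.exp_nat_mul, hnu, Complex.exp_add, Complex.exp_int_mul_two_pi_mul_I, one_mul,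
    Complex.exp_log (hpg hup hen)]
  simp only [g]
  push_cast
  field_simp

/-! ### Generating functions and divided differences -/

theorem hasSum_of_forall_eq {f g : ℕ → ℂ} {x y : ℂ} (h : HasSum f x) (hfg : ∀ m, g m = f m)
    (hxy : y = x) : HasSum g y := by
  rwa [hxy, funext hfg]

theorem coeff_eq_of_hasSum_pow {p q : ℕ → ℂ} {f : ℂ → ℂ}
    (hp : ∀ᶠ t in 𝓝 (0 : ℂ), HasSum (fun m => p m * t ^ m) (f t))
    (hq : ∀ᶠ t in 𝓝 (0 : ℂ), HasSum (fun m => q m * t ^ m) (f t)) : p = q := by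
  have key : ∀ r : ℕ → ℂ, (∀ᶠ t in 𝓝 (0 : ℂ), HasSum (fun m => r m * t ^ m) (f t)) →
      HasFPowerSeriesAt f (FormalMultilinearSeries.ofScalars ℂ r) 0 := by
    intro r hr
    rw [hasFPowerSeriesAt_iff]
    filter_upwards [hr] with t ht
    simpa [FormalMultilinearSeries.coeff_ofScalars, mul_comm] using ht
  have h := (key p hp).eq_formalMultilinearSeries (key q hq)
  funext m
  simpa [FormalMultilinearSeries.coeff_ofScalars] using
    congrArg (fun s : FormalMultilinearSeries ℂ ℂ ℂ => s.coeff m) h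

theorem hasSum_quadratic_inv {α β : ℂ} (hαβ : α ≠ β) :
    ∀ᶠ t in 𝓝 (0 : ℂ), HasSum (fun m : ℕ => (α ^ (m + 1) - β ^ (m + 1)) / (α - β) * t ^ m)
      (1 / ((1 - α * t) * (1 - β * t))) := by
  have hsmall : ∀ γ : ℂ, ∀ᶠ t in 𝓝 (0 : ℂ), ‖γ * t‖ < 1 := fun γ =>
    (Continuous.tendsto' (f := fun t : ℂ => ‖γ * t‖) (by fun_prop) 0 0 (by simp)).eventually_lt_const
      one_pos
  filter_upwards [hsmall α, hsmall β] with t h1 h2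
  have hne : ∀ γ : ℂ, ‖γ * t‖ < 1 → 1 - γ * t ≠ 0 := by
    intro γ h h0
    rw [← sub_eq_zero.1 h0] at h
    simp at h
  have := ((hasSum_geometric_of_norm_lt_one h1).mul_left α).sub
    ((hasSum_geometric_of_norm_lt_one h2).mul_left β)
  have := this.mul_left (α - β)⁻¹
  have hd := sub_ne_zero.2 hαβ
  have e1 := hne α h1
  have e2 := hne β h2
  refine hasSum_of_forall_eq this (fun m => ?_) ?_
  · rw [mul_pow, mul_pow]
    field_simp
    ring
  · rw [inv_mul_eq_div, ← div_eq_mul_inv, ← div_eq_mul_inv, div_sub_div _ _ e1 e2, div_div,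
      div_eq_div_iff (mul_ne_zero e1 e2) (mul_ne_zero (mul_ne_zero e1 e2) hd)]
    ring

theorem hasSum_one_sub_mul {p : ℕ → ℂ} {t z A : ℂ} (h : HasSum (fun m => p m * t ^ m) A) :
    HasSum (fun m => (p m - z * (if m = 0 then 0 else p (m - 1))) * t ^ m) ((1 - t * z) * A) := by
  have h2 : HasSum (fun m => (if m = 0 then 0 else p (m - 1)) * t ^ m) (t * A) := by
    rw [← hasSum_nat_add_iff' 1]
    simp only [Nat.add_eq_zero_iff, one_ne_zero, and_false, if_false, Nat.add_sub_cancel,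
      Finset.sum_range_one, if_true, zero_mul, sub_zero]
    exact (h.mul_left t).congr_fun fun m => by ring
  refine hasSum_of_forall_eq (h.sub (h2.mul_left z)) (fun m => ?_) ?_
  · ring
  · ring

/-- The bivariate complete homogeneous polynomial of degree `n - 1`. -/
def completeHomog (n : ℕ) (x y : ℂ) : ℂ := ∑ i ∈ Finset.range n, x ^ i * y ^ (n - 1 - i)

theorem completeHomog_mul_sub (n : ℕ) (x y : ℂ) :
    completeHomog n x y * (x - y) = x ^ n - y ^ n := geom_sum₂_mul x y n

theorem completeHomog_succ (n : ℕ) (x y : ℂ) :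
    completeHomog (n + 1) x y = x ^ n + y * completeHomog n x y := geom_sum₂_succ_eq x y

theorem completeHomog_mul_mul (n : ℕ) (r x y : ℂ) :
    completeHomog (n + 1) (r * x) (r * y) = r ^ n * completeHomog (n + 1) x y := by
  rw [completeHomog, completeHomog, Finset.mul_sum]
  refine Finset.sum_congr rfl fun i hi => ?_
  have : i ≤ n := Nat.lt_succ_iff.1 (Finset.mem_range.1 hi)
  obtain ⟨j, rfl⟩ := Nat.exists_eq_add_of_le this
  simp only [Nat.add_sub_cancel, Nat.add_sub_cancel_left, mul_pow, pow_add]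
  ring

theorem norm_completeHomog_le {n : ℕ} {x y : ℂ} {ρ : ℝ} (hx : ‖x‖ ≤ ρ) (hy : ‖y‖ ≤ ρ) :
    ‖completeHomog (n + 1) x y‖ ≤ (n + 1) * ρ ^ n := by
  have : ∀ i ∈ Finset.range (n + 1), ‖x ^ i * y ^ (n + 1 - 1 - i)‖ ≤ ρ ^ n := by
    intro i hi
    have hin : i ≤ n := Nat.lt_succ_iff.1 (Finset.mem_range.1 hi)
    rw [norm_mul, norm_pow, norm_pow, Nat.add_sub_cancel]
    calc ‖x‖ ^ i * ‖y‖ ^ (n - i) ≤ ρ ^ i * ρ ^ (n - i) := by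
          have := (norm_nonneg x).trans hx
          gcongr
      _ = ρ ^ n := by rw [← pow_add, Nat.add_sub_cancel' hin]
  simpa [completeHomog] using norm_sum_le_of_le _ this

/-- `P m (z)` as a divided difference, for a sequence generated by
`1 / (c (1 - α t) (1 - β t) (1 - t z))`. -/
theorem mul_coeff_eq_completeHomog_sub {p : ℕ → ℂ} {α β c z : ℂ} (hαβ : α ≠ β) (hc : c ≠ 0)
    (h : ∀ᶠ t in 𝓝 (0 : ℂ), HasSum (fun m => p m * t ^ m)
      (1 / ((c * (1 - α * t) * (1 - β * t)) * (1 - t * z)))) (m : ℕ) :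
    c * (α - β) * p m = completeHomog (m + 2) α z - completeHomog (m + 2) β z := by
  have hd := sub_ne_zero.2 hαβ
  have hne : ∀ᶠ t in 𝓝 (0 : ℂ), 1 - t * z ≠ 0 :=
    ContinuousAt.eventually_ne (by fun_prop) (by simp)
  have h1 : ∀ᶠ t in 𝓝 (0 : ℂ), HasSum
      (fun m => c * (p m - z * (if m = 0 then 0 else p (m - 1))) * t ^ m)
      (1 / ((1 - α * t) * (1 - β * t))) := by
    filter_upwards [h, hne] with t ht h0
    refine hasSum_of_forall_eq ((hasSum_one_sub_mul (z := z) ht).mul_left c) (fun m => ?_) ?_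
    · ring
    · field_simp
  -- Clearing the factor `1 - t * z` yields a first-order recurrence in `m`, which
  -- `completeHomog_succ` matches.
  have hrec := congrFun (coeff_eq_of_hasSum_pow h1 (hasSum_quadratic_inv hαβ))
  induction m with
  | zero =>
    have := hrec 0
    simp only [if_true, zero_add, pow_one, mul_zero, sub_zero, div_self hd] at this
    simp only [completeHomog, Finset.sum_range_succ, Finset.sum_range_zero]
    norm_num
    linear_combination (α - β) * this
  | succ k ih =>
    have := hrec (k + 1)
    rw [eq_div_iff hd] at this
    simp only [Nat.add_eq_zero_iff, one_ne_zero, and_false, if_false, Nat.add_sub_cancel] at this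
    rw [completeHomog_succ, completeHomog_succ (k + 2)]
    linear_combination this + z * ih

/-! ### Limit sets as filter statements -/

theorem liminfZeros_subset_limsupZeros (D : Set ℂ) (f : ℕ → ℂ → ℂ) :
    liminfZeros D f ⊆ limsupZeros D f := by
  rintro z ⟨hz, h⟩
  refine ⟨hz, fun r hr N => ?_⟩
  obtain ⟨M, hM⟩ := h r hr
  exact ⟨max M N + 1, by omega, hM _ (by omega)⟩

theorem mem_liminfZeros_univ_iff {f : ℕ → ℂ → ℂ} {z : ℂ} :
    z ∈ liminfZeros Set.univ f ↔
      ∀ r > 0, ∀ᶠ m in atTop, ∃ w, dist w z < r ∧ f m w = 0 := by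
  simp only [liminfZeros, zerosIn, Set.mem_univ, true_and, Set.mem_ofPred_eq]
  refine forall₂_congr fun r _ => ⟨fun ⟨N, hN⟩ => ?_, fun h => ?_⟩
  · exact (eventually_gt_atTop N).mono hN
  · obtain ⟨N, hN⟩ := eventually_atTop.1 h
    exact ⟨N, fun m hm => hN m hm.le⟩

theorem mem_limsupZeros_univ_iff {f : ℕ → ℂ → ℂ} {z : ℂ} :
    z ∈ limsupZeros Set.univ f ↔
      ∀ r > 0, ∃ᶠ m in atTop, ∃ w, dist w z < r ∧ f m w = 0 := by
  simp only [limsupZeros, zerosIn, Set.mem_univ, true_and, Set.mem_ofPred_eq]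
  exact forall₂_congr fun r _ => frequently_atTop'.symm

/-! ### Zeros of the normalized polynomials -/

/-- Up to constants and scaling, the polynomials generated by
`1 / ((1 - t) (1 - s t) (1 - t w))`. -/
def homogDiff (s : ℝ) (m : ℕ) (w : ℂ) : ℂ :=
  completeHomog (m + 2) 1 w - completeHomog (m + 2) s w

theorem homogDiff_mul_mul (s : ℝ) (m : ℕ) (w : ℂ) :
    homogDiff s m w * ((w - 1) * (w - s)) =
      w ^ (m + 2) * (1 - s) - ((w - s) - s ^ (m + 2) * (w - 1)) := by
  have h1 := completeHomog_mul_sub (m + 2) 1 w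
  have h2 := completeHomog_mul_sub (m + 2) s w
  rw [one_pow] at h1
  rw [homogDiff]
  linear_combination (-(w - s)) * h1 + (w - 1) * h2

theorem mem_liminfZeros_homogDiff {s : ℝ} (hs : |s| < 1) {w₀ : ℂ} (hw₀ : ‖w₀‖ = 1) :
    w₀ ∈ liminfZeros Set.univ (homogDiff s) := by
  rw [mem_liminfZeros_univ_iff]
  intro r hr
  obtain ⟨θ, hθ⟩ := (Complex.norm_eq_one_iff w₀).1 hw₀
  obtain ⟨φ, hφ, hφr⟩ : ∃ φ : ℝ, Real.sin φ ≠ 0 ∧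
      dist (Complex.exp (φ * Complex.I)) w₀ < r := by
    -- If `w₀ = ±1`, a slight rotation gives a nonreal point still in the ball.
    by_cases h : Real.sin θ = 0
    · have hc : Real.cos θ ≠ 0 := fun h' => by
        simpa [h, h'] using Real.sin_sq_add_cos_sq θ
      have hcont : Tendsto (fun δ : ℝ => Complex.exp (((θ + δ : ℝ) : ℂ) * Complex.I))
          (𝓝[>] 0) (𝓝 w₀) :=
        (Continuous.tendsto' (by fun_prop) 0 w₀ (by simpa using hθ)).mono_left nhdsWithin_le_nhds
      obtain ⟨δ, h1, h2⟩ := ((hcont.eventually (Metric.ball_mem_nhds w₀ hr)).and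
        (Ioo_mem_nhdsGT Real.pi_pos)).exists
      refine ⟨θ + δ, ?_, h1⟩
      rw [Real.sin_add, h, zero_mul, zero_add]
      exact mul_ne_zero hc (Real.sin_pos_of_mem_Ioo h2).ne'
    · exact ⟨θ, h, by simpa [hθ] using hr⟩
  have hev := eventually_exists_pow_mul_eq hs hφ (Metric.isOpen_ball.mem_nhds hφr)
  filter_upwards [(tendsto_add_atTop_nat 2).eventually hev] with m ⟨w, hw, him, hwm⟩
  refine ⟨w, hw, ?_⟩
  have h := homogDiff_mul_mul s m w
  rw [hwm, sub_self] at h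
  -- The spurious solutions `1` and `s` are real, while `w` is not.
  refine (mul_eq_zero.1 h).resolve_right (mul_ne_zero ?_ ?_) <;> intro h0 <;>
    apply him <;> rw [sub_eq_zero.1 h0] <;> simp

/-- At a zero, `1 = w ^ (m + 2) + completeHomog (m + 2) s w * (1 - w)`, whose right side is `O(m σ ^
m)`. The factor `w - s` is not multiplied in, since it would add the spurious root `s`. -/
theorem eventually_homogDiff_ne_zero_of_lt {s : ℝ} (hs : |s| < 1) {ρ : ℝ} (hρ0 : 0 ≤ ρ)
    (hρ : ρ < 1) : ∀ᶠ m in atTop, ∀ w : ℂ, ‖w‖ ≤ ρ → homogDiff s m w ≠ 0 := by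
  set σ := max |s| ρ with hσ
  have hσ1 : σ < 1 := max_lt hs hρ
  have hσ0 : 0 ≤ σ := le_max_of_le_right hρ0
  have hlim : Tendsto (fun m : ℕ => 4 * (((m + 1 : ℕ) + 1 : ℝ) * σ ^ (m + 1))) atTop (𝓝 0) := by
    have h1 := tendsto_self_mul_const_pow_of_lt_one hσ0 hσ1
    have h2 := tendsto_pow_atTop_nhds_zero_of_lt_one hσ0 hσ1
    have := (((h1.add h2).const_mul 4).comp (tendsto_add_atTop_nat 1))
    simp only [add_zero, mul_zero] at this
    refine this.congr fun m => ?_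
    simp only [Function.comp]
    ring
  filter_upwards [hlim.eventually_lt_const one_pos] with m hm w hw h0
  have hwσ : ‖w‖ ≤ σ := hw.trans (le_max_right _ _)
  have hb := norm_completeHomog_le (n := m + 1) (x := s) (y := w) (by simp [hσ]) hwσ
  have h1 := completeHomog_mul_sub (m + 2) 1 w
  rw [sub_eq_zero.1 h0, one_pow] at h1
  have hone : (1 : ℂ) = w ^ (m + 2) + completeHomog (m + 2) s w * (1 - w) := by
    linear_combination -h1
  have hn : (1 : ℝ) ≤ ‖w‖ ^ (m + 2) + ‖completeHomog (m + 2) s w‖ * 2 := by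
    calc (1 : ℝ) = ‖(1 : ℂ)‖ := by simp
      _ ≤ ‖w ^ (m + 2)‖ + ‖completeHomog (m + 2) s w * (1 - w)‖ := by
        conv_lhs => rw [hone]
        exact norm_add_le _ _
      _ ≤ _ := by
        rw [norm_pow, norm_mul]
        gcongr
        calc ‖1 - w‖ ≤ ‖(1 : ℂ)‖ + ‖w‖ := norm_sub_le _ _
          _ ≤ 2 := by rw [norm_one]; linarith
  have hp : ‖w‖ ^ (m + 2) ≤ σ ^ (m + 1) :=
    (pow_le_pow_left₀ (norm_nonneg w) hwσ _).trans (pow_le_pow_of_le_one hσ0 hσ1.le (by omega))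
  have hσm : 0 ≤ σ ^ (m + 1) := by positivity
  have hm0 : (0 : ℝ) ≤ (m : ℝ) := by positivity
  push_cast at hm hb
  nlinarith [mul_nonneg hm0 hσm]

/-- The term `w ^ (m + 2) * (1 - s)` outgrows the other side, which is at most `4 * ‖w‖`. -/
theorem eventually_homogDiff_ne_zero_of_gt {s : ℝ} (hs : |s| < 1) {ρ : ℝ} (hρ : 1 < ρ) :
    ∀ᶠ m in atTop, ∀ w : ℂ, ρ ≤ ‖w‖ → homogDiff s m w ≠ 0 := by
  have hs1 : 0 < 1 - s := by linarith [le_abs_self s]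
  have hlim := (tendsto_pow_atTop_atTop_of_one_lt hρ).comp (tendsto_add_atTop_nat 1)
  filter_upwards [hlim.eventually_gt_atTop (4 / (1 - s))] with m hm w hw h0
  rw [div_lt_iff₀ hs1, Function.comp] at hm
  have hw1 : 1 < ‖w‖ := hρ.trans_le hw
  have h := homogDiff_mul_mul s m w
  rw [h0, zero_mul, eq_comm, sub_eq_zero] at h
  have hn := congrArg norm h
  have hns : ‖(1 - s : ℂ)‖ = 1 - s := by
    rw [← Complex.ofReal_one, ← Complex.ofReal_sub, Complex.norm_real, Real.norm_of_nonneg hs1.le]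
  rw [norm_mul, norm_pow, hns] at hn
  have hle : ‖(w - s) - s ^ (m + 2) * (w - 1)‖ ≤ 4 * ‖w‖ := by
    have e1 : ‖w - (s : ℂ)‖ ≤ ‖w‖ + |s| := by simpa using norm_sub_le w (s : ℂ)
    have e2 : ‖w - 1‖ ≤ ‖w‖ + 1 := by simpa using norm_sub_le w 1
    have e3 : ‖(s : ℂ) ^ (m + 2) * (w - 1)‖ ≤ 1 * (‖w‖ + 1) := by
      rw [norm_mul, norm_pow, Complex.norm_real, Real.norm_eq_abs]
      exact mul_le_mul (pow_le_one₀ (abs_nonneg s) hs.le) e2 (norm_nonneg _) one_pos.le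
    linarith [norm_sub_le (w - (s : ℂ)) (s ^ (m + 2) * (w - 1))]
  have hp : ρ ^ (m + 1) ≤ ‖w‖ ^ (m + 1) := pow_le_pow_left₀ (by linarith) hw _
  have : 4 < ‖w‖ ^ (m + 1) * (1 - s) := hm.trans_le (mul_le_mul_of_nonneg_right hp hs1.le)
  rw [← hn, show m + 2 = (m + 1) + 1 from rfl, pow_succ] at hle
  nlinarith

theorem norm_eq_one_of_mem_limsupZeros_homogDiff {s : ℝ} (hs : |s| < 1) {w₀ : ℂ}
    (hw₀ : w₀ ∈ limsupZeros Set.univ (homogDiff s)) : ‖w₀‖ = 1 := by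
  rw [mem_limsupZeros_univ_iff] at hw₀
  rcases lt_trichotomy ‖w₀‖ 1 with h | h | h
  · obtain ⟨ρ, h1, h2⟩ := exists_between h
    obtain ⟨m, ⟨w, hw, hm⟩, hne⟩ := ((hw₀ (ρ - ‖w₀‖) (by linarith)).and_eventually
      (eventually_homogDiff_ne_zero_of_lt hs ((norm_nonneg _).trans h1.le) h2)).exists
    rw [dist_eq_norm] at hw
    exact absurd hm (hne w (by linarith [norm_le_norm_add_norm_sub' w w₀]))
  · exact h
  · obtain ⟨ρ, h1, h2⟩ := exists_between h
    obtain ⟨m, ⟨w, hw, hm⟩, hne⟩ := ((hw₀ (‖w₀‖ - ρ) (by linarith)).and_eventually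
      (eventually_homogDiff_ne_zero_of_gt hs h1)).exists
    rw [dist_comm, dist_eq_norm] at hw
    exact absurd hm (hne w (by linarith [norm_le_norm_add_norm_sub' w₀ w]))

/-! ### Reduction to the normalized polynomials -/

theorem exists_real_roots {a b c : ℝ} (ha : a ≠ 0) (hb : b ≠ 0)
    (hdisc : 0 < b ^ 2 - 4 * a * c) {t₁ : ℂ}
    (ht₁ : (a : ℂ) * t₁ ^ 2 + (b : ℂ) * t₁ + (c : ℂ) = 0)
    (hmin : ∀ t : ℂ, (a : ℂ) * t ^ 2 + (b : ℂ) * t + (c : ℂ) = 0 → ‖t₁‖ ≤ ‖t‖) :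
    ∃ x y : ℝ, t₁ = x ∧ |x| < |y| ∧ b = -(a * (x + y)) ∧ c = a * x * y := by
  have hac : (a : ℂ) ≠ 0 := by exact_mod_cast ha
  set d := Real.sqrt (b ^ 2 - 4 * a * c) with hd
  have hd0 : 0 < d := Real.sqrt_pos.2 hdisc
  have hdd : d * d = b ^ 2 - 4 * a * c := Real.mul_self_sqrt hdisc.le
  obtain ⟨x, hx⟩ : ∃ x : ℝ, t₁ = x := by
    have hdc : discrim (a : ℂ) b c = (d : ℂ) * d := by
      rw [discrim]; exact_mod_cast hdd.symm
    rcases (quadratic_eq_zero_iff hac hdc t₁).1 (by linear_combination ht₁) with h | h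
    · exact ⟨(-b + d) / (2 * a), by rw [h]; push_cast; rfl⟩
    · exact ⟨(-b - d) / (2 * a), by rw [h]; push_cast; rfl⟩
  subst hx
  have hxr : a * x ^ 2 + b * x + c = 0 := by exact_mod_cast ht₁
  obtain ⟨y, hy⟩ : ∃ y : ℝ, b = -(a * (x + y)) := ⟨-b / a - x, by field_simp; ring⟩
  have hc' : c = a * x * y := by rw [hy] at hxr; linear_combination hxr
  refine ⟨x, y, rfl, lt_of_le_of_ne ?_ ?_, hy, hc'⟩
  · have := hmin y (by rw [hy, hc']; push_cast; ring)
    simpa using this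
  -- Equal moduli would mean a double root, against `hdisc`, or opposite roots, against `b ≠ 0`.
  · intro h
    rcases abs_eq_abs.1 h with h | h
    · rw [hy, hc', h] at hdisc
      nlinarith
    · exact hb (by rw [hy, h]; ring)

theorem theorem3 (a b c : ℝ) (ha : a ≠ 0) (hb : b ≠ 0) (hc : c ≠ 0)
    (hdisc : 0 < b ^ 2 - 4 * a * c)
    (P : ℕ → ℂ → ℂ)
    (hP : HasGeneratingFunction P
      (fun t z => 1 / (((a : ℂ) * t ^ 2 + (b : ℂ) * t + (c : ℂ)) * (1 - t * z))))
    (t₁ : ℂ) (ht₁ : (a : ℂ) * t₁ ^ 2 + (b : ℂ) * t₁ + (c : ℂ) = 0)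
    (hmin : ∀ t : ℂ, (a : ℂ) * t ^ 2 + (b : ℂ) * t + (c : ℂ) = 0 → ‖t₁‖ ≤ ‖t‖) :
    liminfZeros Set.univ P = limsupZeros Set.univ P ∧
      limsupZeros Set.univ P = {z : ℂ | ‖z‖ = 1 / ‖t₁‖} := by
  obtain ⟨x, y, rfl, hxy, hbxy, hcxy⟩ := exists_real_roots ha hb hdisc ht₁ hmin
  have hx : x ≠ 0 := by rintro rfl; simp [hcxy] at hc
  have hy : y ≠ 0 := by rintro rfl; simp [hcxy] at hc
  have hxc : (x : ℂ) ≠ 0 := by exact_mod_cast hx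
  have hyc : (y : ℂ) ≠ 0 := by exact_mod_cast hy
  have hcc : (c : ℂ) ≠ 0 := by exact_mod_cast hc
  have hne : (x : ℂ)⁻¹ ≠ (y : ℂ)⁻¹ := by
    rw [Ne, inv_inj, Complex.ofReal_inj]
    rintro rfl
    exact hxy.false
  have hs : |x / y| < 1 := by
    rw [abs_div, div_lt_one (abs_pos.2 hy)]; exact hxy
  have hzero : ∀ m z, P m z = 0 ↔ homogDiff (x / y) m (x * z) = 0 := by
    intro m z
    have hgen := mul_coeff_eq_completeHomog_sub (p := fun m => P m z) (z := z) hne hcc (by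
      filter_upwards [hP z] with t ht
      convert ht using 4
      rw [hbxy, hcxy]
      push_cast
      field_simp
      ring) m
    -- By homogeneity, `x⁻¹` factors out of the triple `x⁻¹`, `y⁻¹`, `z`, leaving `1`, `x / y`, `x *
    -- z`.
    have h1 := completeHomog_mul_mul (m + 1) (x : ℂ)⁻¹ 1 (x * z)
    have h2 := completeHomog_mul_mul (m + 1) (x : ℂ)⁻¹ (x / y : ℝ) (x * z)
    rw [mul_one, inv_mul_cancel_left₀ hxc] at h1
    rw [Complex.ofReal_div, div_eq_mul_inv, inv_mul_cancel_left₀ hxc,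
      inv_mul_cancel_left₀ hxc, ← div_eq_mul_inv, ← Complex.ofReal_div] at h2
    rw [h1, h2, ← mul_sub] at hgen
    have hk : (c : ℂ) * ((x : ℂ)⁻¹ - (y : ℂ)⁻¹) ≠ 0 := mul_ne_zero hcc (sub_ne_zero.2 hne)
    have hk' : (x : ℂ)⁻¹ ^ (m + 1) ≠ 0 := pow_ne_zero _ (inv_ne_zero hxc)
    rw [← mul_eq_zero_iff_left hk, hgen, mul_eq_zero_iff_left hk', homogDiff]
  have hx0 : 0 < |x| := abs_pos.2 hx
  have hdist : ∀ u v : ℂ, dist (x * u) (x * v) = |x| * dist u v := fun u v => by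
    rw [dist_eq_norm, dist_eq_norm, ← mul_sub, norm_mul, Complex.norm_real, Real.norm_eq_abs]
  have hcircle : ∀ z : ℂ, ‖z‖ = 1 / ‖(x : ℂ)‖ ↔ ‖(x : ℂ) * z‖ = 1 := fun z => by
    rw [norm_mul, eq_div_iff (norm_ne_zero_iff.2 hxc), mul_comm]
  have hsup : limsupZeros Set.univ P ⊆ {z : ℂ | ‖z‖ = 1 / ‖(x : ℂ)‖} := by
    intro z hz
    rw [mem_limsupZeros_univ_iff] at hz
    refine (hcircle z).2 (norm_eq_one_of_mem_limsupZeros_homogDiff hs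
      (mem_limsupZeros_univ_iff.2 fun r hr => ?_))
    refine (hz (r / |x|) (div_pos hr hx0)).mono fun m ⟨w, hw, hm⟩ => ⟨x * w, ?_, (hzero m w).1 hm⟩
    rw [hdist, mul_comm]
    exact (lt_div_iff₀ hx0).1 hw
  have hinf : {z : ℂ | ‖z‖ = 1 / ‖(x : ℂ)‖} ⊆ liminfZeros Set.univ P := by
    intro z hz
    have hmem := mem_liminfZeros_univ_iff.1 (mem_liminfZeros_homogDiff hs ((hcircle z).1 hz))
    refine mem_liminfZeros_univ_iff.2 fun r hr => ?_
    refine (hmem (|x| * r) (mul_pos hx0 hr)).mono fun m ⟨w, hw, hm⟩ => ⟨(x : ℂ)⁻¹ * w, ?_, ?_⟩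
    · rw [← mul_lt_mul_iff_right₀ hx0, ← hdist, mul_inv_cancel_left₀ hxc]
      exact hw
    · rwa [hzero, mul_inv_cancel_left₀ hxc]
  have hsub := liminfZeros_subset_limsupZeros Set.univ P
  exact ⟨hsub.antisymm (hsup.trans hinf), hsup.antisymm (hinf.trans hsub)⟩
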